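/- Let $\mathbb{Z}_2^2=\mathbb{Z}_2\times\mathbb{Z}_2$ and $\mathbf{a}\cdot\mathbf{b}=a_1b_1+a_2b_2$. A $\mathbb{Z}_2^2$-graded Lie superalgebra is a complex vector space $\mathfrak{g}=\bigoplus_{\mathbf{a}\in\mathbb{Z}_2^2}\mathfrak{g}_{\mathbf{a}}$ with a bilinear bracket such that, for homogeneous $x,y,z$ of degrees $\mathbf{a},\mathbf{b},\mathbf{c}$, one has $[x,y]\in\mathfrak{g}_{\mathbf{a}+\mathbf{b}}$, $[x,y]=-(-1)^{\mathbf{a}\cdot\mathbf{b}}[y,x]$ and $$(-1)^{\mathbf{a}\cdot\mathbf{c}}[x,[y,z]]+(-1)^{\mathbf{b}\cdot\mathbf{a}}[y,[z,x]]+(-1)^{\mathbf{c}\cdot\mathbf{b}}[z,[x,y]]=0.$$ Let $\mathfrak{g}^8$ be the eight-dimensional $\mathbb{Z}_2^2$-graded $osp(1|2)$, with basis $(X^1,\dots,X^8)=(L^+,R,L^-,\tilde R,a^+,a^-,\tilde a^+,\tilde a^-)$, where $L^\pm,R$ have degree $(0,0)$, $\tilde R$ degree $(1,1)$, $a^\pm$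 degree $(0,1)$, $\tilde a^\pm$ degree $(1,0)$. Its non-vanishing brackets, up to graded skew-symmetry, are $$[R,L^\pm]=\pm2L^\pm,\quad [L^+,L^-]=-R,\quad [R,a^\pm]=\pm a^\pm,\quad [R,\tilde a^\pm]=\pm\tilde a^\pm,\quad [L^\pm,a^\mp]=\mp a^\pm,\quad [L^\pm,\tilde a^\mp]=\pm\tilde a^\pm,$$ $$[\tilde R,a^\pm]=\pm\tilde a^\pm,\quad [\tilde R,\tilde a^\pm]=\mp a^\pm,\quad [a^+,a^-]=[\tilde a^+,\tilde a^-]=2R,\quad [a^\pm,\tilde a^\mp]=2\tilde R,\quad [a^\pm,a^\pm]=4L^\pm,\quad [\tilde a^\pm,\tilde a^\pm]=-4L^\pm .$$ Let $g^{ab}=\mathrm{Str}(\mathrm{ad}X^a\,\mathrm{ad}X^b)$ be the $\mathbb{Z}_2^2$-Killing form, where $\mathrm{Str}$ is the trace in which the diagonal blocks of degrees $(0,0),(1,1)$ are counted with sign $+$ and those of degrees $(0,1),(1,0)$ with sign $-$. Let $L(\mathfrak{g}^8)=\mathbb{C}[\lambda,\lambda^{-1}]\otimes\mathfrak{g}^8$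 be the loop algebra ($\lambda$ has degree $(0,0)$), with basis $X^a_m=\lambda^m\otimes X^a$, $m\in\mathbb{Z}$. Then: (0) $L(\mathfrak{g}^8)$ is a $\mathbb{Z}_2^2$-graded Lie superalgebra. (1) Let $V$ be a $\mathbb{Z}_2^2$-graded complex vector space and $\omega:L(\mathfrak{g}^8)\times L(\mathfrak{g}^8)\to V$ a 2-cocycle, i.e. a bilinear map such that for homogeneous $x,y,z$ of degrees $\mathbf{a},\mathbf{b},\mathbf{c}$: $\omega(x,y)\in V_{\mathbf{a}+\mathbf{b}}$, $\omega(x,y)=-(-1)^{\mathbf{a}\cdot\mathbf{b}}\omega(y,x)$ and $$(-1)^{\mathbf{a}\cdot\mathbf{c}}\omega(x,[y,z])+(-1)^{\mathbf{b}\cdot\mathbf{a}}\omega(y,[z,x])+(-1)^{\mathbf{c}\cdot\mathbf{b}}\omega(z,[x,y])=0.$$ Then there is exactly one $c\in V_{(0,0)}$ such that $\omega$ differs from the bilinear map $$\omega_c(X^a_m,X^b_n)=g^{ab}\,m\,\delta_{m+n,0}\,c$$ by a coboundary $(x,y)\mapsto f([x,y])$, with $f:L(\mathfrak{g}^8)\to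 V$ linear and degree preserving. (2) Conversely, for every $V$ and every $c\in V_{(0,0)}$ the map $\omega_c$ is a 2-cocycle, and $L(\mathfrak{g}^8)\oplus V$ with the bracket $[(x,u),(y,v)]=([x,y],\omega_c(x,y))$ is a central extension of $L(\mathfrak{g}^8)$. (3) Let $\pi:E\to L(\mathfrak{g}^8)$ be any central extension, i.e. a surjective degree-preserving homomorphism of $\mathbb{Z}_2^2$-graded Lie superalgebras with central kernel. Then there is exactly one $c\in\ker\pi$ of degree $(0,0)$ for which there exists a degree-preserving linear section $s$ of $\pi$ with $$[s(X^a_m),s(X^b_n)]=s([X^a_m,X^b_n])+g^{ab}\,m\,\delta_{m+n,0}\,c\qquad\text{for all }a,b,m,n.$$ -/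

import Mathlib

open scoped TensorProduct

noncomputable section

/-- The group `ℤ₂²` of degrees. -/
abbrev Z22 : Type := ZMod 2 × ZMod 2

/-- The scalar product `a · b = a₁ b₁ + a₂ b₂` of degrees, with values in `ℤ₂`. -/
def Z22.dot (a b : Z22) : ZMod 2 := a.1 * b.1 + a.2 * b.2

/-- The sign `(-1)^(a · b)`. -/
def Z22.sign (a b : Z22) : ℂ := (-1) ^ (Z22.dot a b).val

/-- `V = ⨁ 𝒱 a` with the bilinear bracket `br` is a `ℤ₂²`-graded Lie superalgebra. -/
structure IsZ22LieSuperalgebra {V : Type*} [AddCommGroup V] [Module ℂ V]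
    (𝒱 : Z22 → Submodule ℂ V) (br : V →ₗ[ℂ] V →ₗ[ℂ] V) : Prop where
  isInternal : DirectSum.IsInternal 𝒱
  bracket_mem : ∀ a b : Z22, ∀ x ∈ 𝒱 a, ∀ y ∈ 𝒱 b, br x y ∈ 𝒱 (a + b)
  bracket_symm : ∀ a b : Z22, ∀ x ∈ 𝒱 a, ∀ y ∈ 𝒱 b, br x y = -(Z22.sign a b • br y x)
  jacobi : ∀ a b c : Z22, ∀ x ∈ 𝒱 a, ∀ y ∈ 𝒱 b, ∀ z ∈ 𝒱 c,
    Z22.sign a c • br x (br y z) + Z22.sign b a • br y (br z x)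
      + Z22.sign c b • br z (br x y) = 0

/-! ### Central extensions and 2-cocycles -/

section Cohomology

variable {L V E : Type*} [AddCommGroup L] [Module ℂ L] [AddCommGroup V] [Module ℂ V]
  [AddCommGroup E] [Module ℂ E]

/-- A linear map which preserves degrees. -/
def IsDegreePreserving (𝓛 : Z22 → Submodule ℂ L) (𝒱 : Z22 → Submodule ℂ V)
    (f : L →ₗ[ℂ] V) : Prop :=
  ∀ a : Z22, ∀ x ∈ 𝓛 a, f x ∈ 𝒱 a

/-- `π : E → L` exhibits the `ℤ₂²`-graded Lie superalgebra `E` as a central extension of `L`: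
it is a surjective, degree preserving homomorphism whose kernel is central in `E`. -/
structure IsCentralExtension (𝓛 : Z22 → Submodule ℂ L) (brL : L →ₗ[ℂ] L →ₗ[ℂ] L)
    (𝓔 : Z22 → Submodule ℂ E) (brE : E →ₗ[ℂ] E →ₗ[ℂ] E) (π : E →ₗ[ℂ] L) : Prop where
  isLie : IsZ22LieSuperalgebra 𝓔 brE
  degree : IsDegreePreserving 𝓔 𝓛 π
  hom : ∀ x y : E, π (brE x y) = brL (π x) (π y)
  surjective : Function.Surjective π
  central : ∀ z : E, π z = 0 → ∀ x : E, brE x z = 0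

/-- `ω` is a 2-cocycle of `L` with values in the graded space `V` of central elements:
`deg ω(x, y) = deg x + deg y`, graded skew-symmetry, and the cocycle identity. -/
structure IsTwoCocycle (𝓛 : Z22 → Submodule ℂ L) (br : L →ₗ[ℂ] L →ₗ[ℂ] L)
    (𝒱 : Z22 → Submodule ℂ V) (ω : L →ₗ[ℂ] L →ₗ[ℂ] V) : Prop where
  degree : ∀ a b : Z22, ∀ x ∈ 𝓛 a, ∀ y ∈ 𝓛 b, ω x y ∈ 𝒱 (a + b)
  symm : ∀ a b : Z22, ∀ x ∈ 𝓛 a, ∀ y ∈ 𝓛 b, ω x y = -(Z22.sign a b • ω y x)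
  cocycle : ∀ a b c : Z22, ∀ x ∈ 𝓛 a, ∀ y ∈ 𝓛 b, ∀ z ∈ 𝓛 c,
    Z22.sign a c • ω x (br y z) + Z22.sign b a • ω y (br z x)
      + Z22.sign c b • ω z (br x y) = 0

/-- `ω` is a 2-coboundary: `ω(x, y) = f([x, y])` with `f` linear and degree preserving. -/
def IsTwoCoboundary (𝓛 : Z22 → Submodule ℂ L) (br : L →ₗ[ℂ] L →ₗ[ℂ] L)
    (𝒱 : Z22 → Submodule ℂ V) (ω : L →ₗ[ℂ] L →ₗ[ℂ] V) : Prop :=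
  ∃ f : L →ₗ[ℂ] V, IsDegreePreserving 𝓛 𝒱 f ∧ ∀ x y : L, ω x y = f (br x y)

/-- The bracket `[(x, u), (y, v)] = ([x, y], ω(x, y))` on `L ⊕ V`. -/
def extBracket (br : L →ₗ[ℂ] L →ₗ[ℂ] L) (ω : L →ₗ[ℂ] L →ₗ[ℂ] V) :
    (L × V) →ₗ[ℂ] (L × V) →ₗ[ℂ] (L × V) :=
  (br.compr₂ (LinearMap.inl ℂ L V) + ω.compr₂ (LinearMap.inr ℂ L V)).compl₁₂
    (LinearMap.fst ℂ L V) (LinearMap.fst ℂ L V)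

/-- The grading `(L ⊕ V)_a = L_a ⊕ V_a`. -/
def prodGrading (𝓛 : Z22 → Submodule ℂ L) (𝒱 : Z22 → Submodule ℂ V) :
    Z22 → Submodule ℂ (L × V) :=
  fun a => (𝓛 a).prod (𝒱 a)

end Cohomology

/-! ### Loop algebras -/

section Loop

variable {G : Type*} [AddCommGroup G] [Module ℂ G]

/-- The underlying space `ℂ[λ, λ⁻¹] ⊗ G` of the loop algebra of `G`. -/
abbrev Loop (G : Type*) [AddCommGroup G] [Module ℂ G] : Type _ := LaurentPolynomial ℂ ⊗[ℂ] G

/-- The element `x_m = λ^m ⊗ x` of the loop algebra. -/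
def Loop.mode (m : ℤ) (x : G) : Loop G := (LaurentPolynomial.T m : LaurentPolynomial ℂ) ⊗ₜ[ℂ] x

/-- The bracket `[p ⊗ x, q ⊗ y] = (p q) ⊗ [x, y]`. -/
def Loop.bracket (br : G →ₗ[ℂ] G →ₗ[ℂ] G) : Loop G →ₗ[ℂ] Loop G →ₗ[ℂ] Loop G :=
  TensorProduct.map₂ (LinearMap.mul ℂ (LaurentPolynomial ℂ)) br

/-- The grading of the loop algebra, in which `λ` has degree `(0,0)`: the component of degree `a`
is the image of `ℂ[λ, λ⁻¹] ⊗ G_a`. -/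
def Loop.grading (𝒢 : Z22 → Submodule ℂ G) : Z22 → Submodule ℂ (Loop G) :=
  fun a => LinearMap.range ((𝒢 a).subtype.lTensor (LaurentPolynomial ℂ))

end Loop

/-! ### The eight dimensional `ℤ₂²`-graded `osp(1|2)` -/

namespace G8

/-- Labels of the basis `L⁺, R, L⁻, R̃, a⁺, a⁻, ã⁺, ã⁻`, in this order. -/
inductive Gen : Type where
  | Lp | R | Lm | Rt | ap | am | atp | atm
  deriving DecidableEq

instance : Fintype Gen where
  elems := {.Lp, .R, .Lm, .Rt, .ap, .am, .atp, .atm}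
  complete := by intro i; cases i <;> simp

/-- The underlying vector space. -/
abbrev Space : Type := Gen → ℂ

/-- The basis vectors. -/
def e (i : Gen) : Space := Pi.single i 1

/-- The degrees of the basis vectors. -/
def deg : Gen → Z22
  | .Lp | .R | .Lm => (0, 0)
  | .Rt => (1, 1)
  | .ap | .am => (0, 1)
  | .atp | .atm => (1, 0)

open Gen in
/-- The brackets of the basis vectors. -/
def table : Gen → Gen → Space
  -- `[R, L±] = ± 2 L±`
  | R, Lp => (2 : ℂ) • e Lp
  | Lp, R => (-2 : ℂ) • e Lp
  | R, Lm => (-2 : ℂ) • e Lm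
  | Lm, R => (2 : ℂ) • e Lm
  -- `[L⁺, L⁻] = - R`
  | Lp, Lm => (-1 : ℂ) • e R
  | Lm, Lp => (1 : ℂ) • e R
  -- `[R, a±] = ± a±`
  | R, ap => (1 : ℂ) • e ap
  | ap, R => (-1 : ℂ) • e ap
  | R, am => (-1 : ℂ) • e am
  | am, R => (1 : ℂ) • e am
  -- `[R, ã±] = ± ã±`
  | R, atp => (1 : ℂ) • e atp
  | atp, R => (-1 : ℂ) • e atp
  | R, atm => (-1 : ℂ) • e atm
  | atm, R => (1 : ℂ) • e atm
  -- `[L±, a∓] = ∓ a±`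
  | Lp, am => (-1 : ℂ) • e ap
  | am, Lp => (1 : ℂ) • e ap
  | Lm, ap => (1 : ℂ) • e am
  | ap, Lm => (-1 : ℂ) • e am
  -- `{R̃, a±} = ± ã±`
  | Rt, ap => (1 : ℂ) • e atp
  | ap, Rt => (1 : ℂ) • e atp
  | Rt, am => (-1 : ℂ) • e atm
  | am, Rt => (-1 : ℂ) • e atm
  -- `{R̃, ã±} = ∓ a±`
  | Rt, atp => (-1 : ℂ) • e ap
  | atp, Rt => (-1 : ℂ) • e ap
  | Rt, atm => (1 : ℂ) • e am
  | atm, Rt => (1 : ℂ) • e am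
  -- `{a⁺, a⁻} = 2 R`
  | ap, am => (2 : ℂ) • e R
  | am, ap => (2 : ℂ) • e R
  -- `[a±, ã∓] = 2 R̃`
  | ap, atm => (2 : ℂ) • e Rt
  | atm, ap => (-2 : ℂ) • e Rt
  | am, atp => (2 : ℂ) • e Rt
  | atp, am => (-2 : ℂ) • e Rt
  -- `{ã⁺, ã⁻} = 2 R`
  | atp, atm => (2 : ℂ) • e R
  | atm, atp => (2 : ℂ) • e R
  -- `[L±, ã∓] = ± ã±`
  | Lp, atm => (1 : ℂ) • e atp
  | atm, Lp => (-1 : ℂ) • e atp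
  | Lm, atp => (-1 : ℂ) • e atm
  | atp, Lm => (1 : ℂ) • e atm
  -- `{a±, a±} = 4 L±`
  | ap, ap => (4 : ℂ) • e Lp
  | am, am => (4 : ℂ) • e Lm
  -- `{ã±, ã±} = - 4 L±`
  | atp, atp => (-4 : ℂ) • e Lp
  | atm, atm => (-4 : ℂ) • e Lm
  | _, _ => 0

/-- The bracket of `𝔤⁸`, the bilinear extension of `table`. -/
def bracket : Space →ₗ[ℂ] Space →ₗ[ℂ] Space :=
  (Pi.basisFun ℂ Gen).constr ℂ fun i => (Pi.basisFun ℂ Gen).constr ℂ fun j => table i j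

/-- The grading of `𝔤⁸`. -/
def grading : Z22 → Submodule ℂ Space := fun a => Submodule.span ℂ (e '' {i | deg i = a})

/-- The `ℤ₂²`-graded supertrace of a matrix: the diagonal blocks of degrees `(0,0)` and `(1,1)`
count with sign `+`, those of degrees `(0,1)` and `(1,0)` with sign `-`. -/
def Str (M : Matrix Gen Gen ℂ) : ℂ := ∑ i, Z22.sign (deg i) (deg i) * M i i

/-- The matrix of the adjoint action. -/
def adMatrix (x : Space) : Matrix Gen Gen ℂ := LinearMap.toMatrix' (bracket x)

/-- The `ℤ₂²`-graded Killing form `Str (ad x ad y)`. -/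
def killing (x y : Space) : ℂ := Str (adMatrix x * adMatrix y)

/-- The bracket of the loop algebra `L(𝔤⁸)`. -/
abbrev loopBracket : Loop Space →ₗ[ℂ] Loop Space →ₗ[ℂ] Loop Space := Loop.bracket bracket

/-- The grading of the loop algebra `L(𝔤⁸)`. -/
abbrev loopGrading : Z22 → Submodule ℂ (Loop Space) := Loop.grading grading

/-- The basis vector `X^i_m = λ^m ⊗ X^i` of the loop algebra `L(𝔤⁸)`. -/
def X (i : Gen) (m : ℤ) : Loop Space := Loop.mode m (e i)

/-- The coefficient `g^{ij} m δ_{m+n,0}`. -/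
def affineCoeff (i j : Gen) (m n : ℤ) : ℂ :=
  if m + n = 0 then killing (e i) (e j) * (m : ℂ) else 0

end G8

end

/-! Why the theorem holds. All brackets of basis vectors are integer multiples of single basis
vectors, so the Jacobi identity and the symmetry and invariance of the Killing form are finite
checks over ℤ. Invariance makes the three terms of the cocycle identity for `ω_c` proportional to
`m`, `n`, `p` with one common factor, and `m + n + p = 0` on the support. For the converse, a
coboundary is subtracted so that ω vanishes on `(R_0, X_m)` for `X` of nonzero `ad R`-weight, on
`(L⁺_0, L⁻_m)` and on `(a⁺_0, ã⁻_m)` (`IsNormalized`). The cocycle identity with `R_0` then kills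
every pair of nonzero total weight, and the remaining pairs are all expressed through `φ(m, n) =
ω(R_m, R_n)`, with factor `g^{ij} / 4` (`IsNormalized.apply_X_X`). The triple `R, L⁺, L⁻` gives
`φ(p+m, n) = φ(p, m+n) + φ(m, n+p)`, which with skew-symmetry forces `φ(m, n) = m δ_{m+n,0} φ(1,
-1)`. Uniqueness of `c`: since `[R_1, R_{-1}] = 0`, no coboundary changes `ω(R_1, R_{-1}) = 4c`. A
central extension reduces to cocycles through a degree preserving section `s`: the defect of `s` is
a cocycle with values in the kernel, and the `f` of its coboundary corrects `s` to `s + f`. -/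

noncomputable section

/-! ### Gradings described by homogeneous projections. -/

section Graded

variable {M N : Type*} [AddCommGroup M] [Module ℂ M] [AddCommGroup N] [Module ℂ N]

/-- A family of homogeneous projections onto the submodules `A a`. -/
structure IsGradedProjection (A : Z22 → Submodule ℂ M) (p : Z22 → M →ₗ[ℂ] M) : Prop where
  mem : ∀ a x, p a x ∈ A a
  apply_same : ∀ a, ∀ x ∈ A a, p a x = x
  apply_ne : ∀ a b, a ≠ b → ∀ x ∈ A b, p a x = 0
  sum_apply : ∀ x, ∑ a, p a x = x

theorem IsGradedProjection.isInternal {A : Z22 → Submodule ℂ M} {p : Z22 → M →ₗ[ℂ] M}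
    (h : IsGradedProjection A p) : DirectSum.IsInternal A := by
  let D : DirectSum.Decomposition A := DirectSum.Decomposition.ofLinearMap A
    (∑ a, (DirectSum.lof ℂ Z22 (fun a => A a) a) ∘ₗ (p a).codRestrict (A a) (h.mem a))
    (by
      ext x
      simp [h.sum_apply])
    (by
      ext b x : 2
      simp only [LinearMap.comp_apply, LinearMap.sum_apply, DirectSum.coeLinearMap_lof,
        LinearMap.id_apply]
      rw [Finset.sum_eq_single b]
      · congr 1
        exact Subtype.ext (h.apply_same b x x.2)
      · intro a _ hab
        have : (p a).codRestrict (A a) (h.mem a) (x : M) = 0 :=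
          Subtype.ext (h.apply_ne a b hab x x.2)
        rw [this, map_zero]
      · simp)
  exact DirectSum.Decomposition.isInternal A

theorem DirectSum.IsInternal.exists_isGradedProjection {A : Z22 → Submodule ℂ M}
    (h : DirectSum.IsInternal A) : ∃ p, IsGradedProjection A p := by
  let _ := h.chooseDecomposition
  refine ⟨fun a => (A a).subtype ∘ₗ DirectSum.component ℂ Z22 (fun a => A a) a ∘ₗ
    (DirectSum.decomposeLinearEquiv A).toLinearMap, ?_, ?_, ?_, ?_⟩
  · intro a x
    exact Subtype.prop _
  · intro a x hx
    exact DirectSum.decompose_of_mem_same A hx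
  · intro a b hab x hx
    exact DirectSum.decompose_of_mem_ne A hx hab.symm
  · intro x
    classical
    conv_rhs => rw [← DirectSum.sum_support_decompose A x]
    symm
    apply Finset.sum_subset (Finset.subset_univ _)
    intro a _ ha
    simpa using ha

theorem IsGradedProjection.map_apply {A : Z22 → Submodule ℂ M} {B : Z22 → Submodule ℂ N}
    {p : Z22 → M →ₗ[ℂ] M} {q : Z22 → N →ₗ[ℂ] N} (hp : IsGradedProjection A p)
    (hq : IsGradedProjection B q) {f : M →ₗ[ℂ] N} (hf : IsDegreePreserving A B f)
    (a : Z22) (x : M) : f (p a x) = q a (f x) := by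
  conv_rhs => rw [← hp.sum_apply x, map_sum, map_sum]
  rw [Finset.sum_eq_single a]
  · exact (hq.apply_same a _ (hf a _ (hp.mem a x))).symm
  · intro b _ hb
    exact hq.apply_ne a b hb.symm _ (hf b _ (hp.mem b x))
  · simp

theorem isInternal_prodGrading {A : Z22 → Submodule ℂ M} {B : Z22 → Submodule ℂ N}
    (hA : DirectSum.IsInternal A) (hB : DirectSum.IsInternal B) :
    DirectSum.IsInternal (prodGrading A B) := by
  obtain ⟨p, hp⟩ := hA.exists_isGradedProjection
  obtain ⟨q, hq⟩ := hB.exists_isGradedProjection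
  refine IsGradedProjection.isInternal (p := fun a => (p a).prodMap (q a)) ⟨?_, ?_, ?_, ?_⟩
  · intro a x
    exact ⟨hp.mem a _, hq.mem a _⟩
  · intro a x hx
    exact Prod.ext (hp.apply_same a _ hx.1) (hq.apply_same a _ hx.2)
  · intro a b hab x hx
    exact Prod.ext (hp.apply_ne a b hab _ hx.1) (hq.apply_ne a b hab _ hx.2)
  · intro x
    refine Prod.ext ?_ ?_
    · simp [Prod.fst_sum, hp.sum_apply]
    · simp [Prod.snd_sum, hq.sum_apply]

theorem Module.Basis.isInternal_span {ι : Type*} (b : Module.Basis ι ℂ M) (d : ι → Z22) :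
    DirectSum.IsInternal fun a => Submodule.span ℂ (b '' {i | d i = a}) := by
  classical
  have key (a : Z22) (i : ι) :
      b.constr ℂ (fun i => if d i = a then b i else 0) (b i) = if d i = a then b i else 0 :=
    b.constr_basis ℂ _ i
  refine IsGradedProjection.isInternal
    (p := fun a => b.constr ℂ fun i => if d i = a then b i else 0) ⟨?_, ?_, ?_, ?_⟩
  · intro a x
    induction b.mem_span x using Submodule.span_induction with
    | zero => simp
    | add x y _ _ hx hy => rw [map_add]; exact add_mem hx hy
    | smul c x _ hx => rw [map_smul]; exact Submodule.smul_mem _ _ hx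
    | mem x h =>
      obtain ⟨i, rfl⟩ := h
      rw [key]
      split_ifs with h
      · exact Submodule.subset_span ⟨i, h, rfl⟩
      · exact zero_mem _
  · intro a x hx
    induction hx using Submodule.span_induction with
    | mem x h => obtain ⟨i, hi, rfl⟩ := h; exact (key a i).trans (if_pos hi)
    | zero => simp
    | add x y _ _ hx hy => rw [map_add, hx, hy]
    | smul c x _ hx => rw [map_smul, hx]
  · intro a c hac x hx
    induction hx using Submodule.span_induction with
    | mem x h =>
      obtain ⟨i, hi, rfl⟩ := h
      rw [key, if_neg]
      rintro rfl
      exact hac hi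
    | zero => simp
    | add x y _ _ hx hy => rw [map_add, hx, hy, add_zero]
    | smul c x _ hx => rw [map_smul, hx, smul_zero]
  · intro x
    rw [← LinearMap.sum_apply]
    conv_rhs => rw [← LinearMap.id_apply (R := ℂ) x]
    congr 1
    refine b.ext fun i => ?_
    simp only [LinearMap.sum_apply, key]
    simp

end Graded

/-! ### Signs, integer structure constants and the Killing form of 𝔤⁸. -/

theorem Z22.sign_eq_intCast (a b : Z22) :
    Z22.sign a b = ((if Z22.dot a b = 0 then 1 else -1 : ℤ) : ℂ) := by
  unfold Z22.sign
  generalize Z22.dot a b = t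
  have h : t = 0 ∨ t = 1 := by revert t; decide
  rcases h with rfl | rfl <;> simp [ZMod.val_one]

theorem Z22.sign_comm (a b : Z22) : Z22.sign a b = Z22.sign b a := by
  simp only [Z22.sign, Z22.dot, mul_comm]

namespace G8

open Gen

/-- The label of the basis vector which spans the bracket of two basis vectors. -/
def target : Gen → Gen → Gen
  | R, Lp | Lp, R => Lp
  | R, Lm | Lm, R => Lm
  | R, ap | ap, R => ap
  | R, am | am, R => am
  | R, atp | atp, R => atp
  | R, atm | atm, R => atm
  | Lp, am | am, Lp => ap
  | Lm, ap | ap, Lm => am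
  | Rt, ap | ap, Rt => atp
  | Rt, am | am, Rt => atm
  | Rt, atp | atp, Rt => ap
  | Rt, atm | atm, Rt => am
  | ap, atm | atm, ap | am, atp | atp, am => Rt
  | Lp, atm | atm, Lp => atp
  | Lm, atp | atp, Lm => atm
  | ap, ap | atp, atp => Lp
  | am, am | atm, atm => Lm
  -- Correct for `[L⁺, L⁻]`, `[a⁺, a⁻]` and `[ã⁺, ã⁻]`; in all other cases the bracket is zero and
  -- `R` is a filler, whence the alternative `coeff i j = 0` in `deg_target` and `weight_target`.
  | _, _ => R

/-- The structure constants of `𝔤⁸`. -/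
def coeff : Gen → Gen → ℤ
  | R, Lp => 2
  | Lp, R => -2
  | R, Lm => -2
  | Lm, R => 2
  | Lp, Lm => -1
  | Lm, Lp => 1
  | R, ap => 1
  | ap, R => -1
  | R, am => -1
  | am, R => 1
  | R, atp => 1
  | atp, R => -1
  | R, atm => -1
  | atm, R => 1
  | Lp, am => -1
  | am, Lp => 1
  | Lm, ap => 1
  | ap, Lm => -1
  | Rt, ap => 1
  | ap, Rt => 1
  | Rt, am => -1
  | am, Rt => -1
  | Rt, atp => -1
  | atp, Rt => -1
  | Rt, atm => 1
  | atm, Rt => 1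
  | ap, am => 2
  | am, ap => 2
  | ap, atm => 2
  | atm, ap => -2
  | am, atp => 2
  | atp, am => -2
  | atp, atm => 2
  | atm, atp => 2
  | Lp, atm => 1
  | atm, Lp => -1
  | Lm, atp => -1
  | atp, Lm => 1
  | ap, ap => 4
  | am, am => 4
  | atp, atp => -4
  | atm, atm => -4
  | _, _ => 0

/-- The values of the Killing form on the basis vectors. -/
def killingCoeff : Gen → Gen → ℤ
  | R, R => 4
  | Rt, Rt => 4
  | Lp, Lm | Lm, Lp => -2
  | ap, am => 8
  | am, ap => -8
  | atp, atm => 8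
  | atm, atp => -8
  | _, _ => 0

/-- The sign `(-1)^(deg i · deg j)`. -/
def sgn (i j : Gen) : ℤ := if Z22.dot (deg i) (deg j) = 0 then 1 else -1

theorem sign_deg (i j : Gen) : Z22.sign (deg i) (deg j) = (sgn i j : ℂ) :=
  Z22.sign_eq_intCast _ _

theorem table_eq (i j : Gen) : table i j = (coeff i j : ℂ) • e (target i j) := by
  cases i <;> cases j <;> simp [table, coeff, target]

theorem bracket_e (i j : Gen) : bracket (e i) (e j) = (coeff i j : ℂ) • e (target i j) := by
  have h (i : Gen) : e i = Pi.basisFun ℂ Gen i := by simp [e]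
  rw [← table_eq, h i, h j, bracket, Module.Basis.constr_basis, Module.Basis.constr_basis]

theorem deg_target (i j : Gen) : coeff i j = 0 ∨ deg (target i j) = deg i + deg j := by
  revert i j; decide

theorem coeff_symm (i j : Gen) : coeff i j = -(sgn i j * coeff j i) := by
  revert i j; decide

theorem target_comm (i j : Gen) : target i j = target j i := by
  revert i j; decide

/-- The three double brackets need not be written on the same basis vector, so the Jacobi identity
is compared coefficientwise, `l` being the coordinate. -/
theorem coeff_jacobi (i j k l : Gen) :
    sgn i k * (coeff j k * (coeff i (target j k) * if target i (target j k) = l then 1 else 0))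
    + sgn j i * (coeff k i * (coeff j (target k i) * if target j (target k i) = l then 1 else 0))
    + sgn k j * (coeff i j * (coeff k (target i j) * if target k (target i j) = l then 1 else 0))
      = 0 := by
  revert i j k l; decide +kernel

theorem deg_of_killingCoeff_ne_zero (i j : Gen) : killingCoeff i j = 0 ∨ deg i + deg j = 0 := by
  revert i j; decide

theorem killingCoeff_symm (i j : Gen) : killingCoeff i j = sgn i j * killingCoeff j i := by
  revert i j; decide

/-- Invariance of the Killing form, in the signed cyclic shape in which the cocycle identity uses
it. -/
theorem killingCoeff_invariant (i j k : Gen) :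
    sgn i k * (coeff j k * killingCoeff i (target j k))
      = sgn j i * (coeff k i * killingCoeff j (target k i)) := by
  revert i j k; decide +kernel

theorem killing_e (i j : Gen) : killing (e i) (e j) = (killingCoeff i j : ℂ) := by
  have h : ∀ i j : Gen, ∑ k, sgn k k * ∑ l, (coeff i l * if target i l = k then 1 else 0) *
      (coeff j k * if target j k = l then 1 else 0) = killingCoeff i j := by decide +kernel
  rw [← h]
  have hm (i k l : Gen) : adMatrix (e i) k l
      = ((coeff i l * if target i l = k then 1 else 0 : ℤ) : ℂ) := by
    have : adMatrix (e i) k l = bracket (e i) (e l) k := by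
      simp [adMatrix, LinearMap.toMatrix'_apply, e]
    rw [this, bracket_e]
    simp [e, Pi.single_apply, eq_comm]
  simp only [killing, Str, Matrix.mul_apply, hm, sign_deg]
  push_cast
  rfl

/-! ### Basis of the loop algebra, and reduction of multilinear identities to it. -/

/-- The basis `X^i_m` of the loop algebra. -/
def loopBasis : Module.Basis (ℤ × Gen) ℂ (Loop Space) :=
  (AddMonoidAlgebra.basis ℤ ℂ).tensorProduct (Pi.basisFun ℂ Gen)

theorem loopBasis_apply (m : ℤ) (i : Gen) : loopBasis (m, i) = X i m := by
  rw [loopBasis, Module.Basis.tensorProduct_apply, AddMonoidAlgebra.basis_apply,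
    Pi.basisFun_apply]
  rfl

theorem loopBracket_X (i j : Gen) (m n : ℤ) :
    loopBracket (X i m) (X j n) = (coeff i j : ℂ) • X (target i j) (m + n) := by
  rw [loopBracket, Loop.bracket, X, X, X, Loop.mode, Loop.mode, Loop.mode,
    TensorProduct.map₂_apply_tmul, TensorProduct.map_tmul, LinearMap.mul_apply',
    ← LaurentPolynomial.T_add, bracket_e,
    TensorProduct.tmul_smul]

theorem X_mem (i : Gen) (m : ℤ) : X i m ∈ loopGrading (deg i) :=
  ⟨LaurentPolynomial.T m ⊗ₜ ⟨e i, Submodule.subset_span ⟨i, rfl, rfl⟩⟩, rfl⟩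

theorem loopGrading_eq (a : Z22) :
    loopGrading a = Submodule.span ℂ (loopBasis '' {k | deg k.2 = a}) := by
  apply le_antisymm
  · rintro _ ⟨t, rfl⟩
    induction t using TensorProduct.induction_on with
    | zero => simp
    | add x y hx hy => rw [map_add]; exact add_mem hx hy
    | tmul p y =>
      obtain ⟨y, hy⟩ := y
      rw [LinearMap.lTensor_tmul, Submodule.subtype_apply]
      induction hy using Submodule.span_induction with
      | zero => simp
      | add x y _ _ hx hy => rw [TensorProduct.tmul_add]; exact add_mem hx hy
      | smul c x _ hx => rw [TensorProduct.tmul_smul]; exact Submodule.smul_mem _ _ hx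
      | mem y h =>
        obtain ⟨i, hi, rfl⟩ := h
        dsimp only
        induction (AddMonoidAlgebra.basis ℤ ℂ).mem_span p using Submodule.span_induction with
        | zero => simp
        | add x y _ _ hx hy => rw [TensorProduct.add_tmul]; exact add_mem hx hy
        | smul c x _ hx => rw [← TensorProduct.smul_tmul']; exact Submodule.smul_mem _ _ hx
        | mem p h =>
          obtain ⟨m, rfl⟩ := h
          refine Submodule.subset_span ⟨(m, i), hi, ?_⟩
          rw [loopBasis_apply, AddMonoidAlgebra.basis_apply]
          rfl
  · rw [Submodule.span_le]
    rintro _ ⟨⟨m, i⟩, hi, rfl⟩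
    rw [loopBasis_apply, ← show deg i = a from hi]
    exact X_mem i m

/-- A property of homogeneous elements which is stable under linear combinations holds as soon as
it holds for the basis vectors. -/
theorem loopGrading_induction {a : Z22} {p : Loop Space → Prop}
    (hX : ∀ i m, deg i = a → p (X i m)) (zero : p 0) (add : ∀ x y, p x → p y → p (x + y))
    (smul : ∀ (c : ℂ) x, p x → p (c • x)) {x : Loop Space} (hx : x ∈ loopGrading a) : p x := by
  rw [loopGrading_eq] at hx
  induction hx using Submodule.span_induction with
  | mem x h =>
    obtain ⟨⟨m, i⟩, hi, rfl⟩ := h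
    rw [loopBasis_apply]
    exact hX i m hi
  | zero => exact zero
  | add x y _ _ hx hy => exact add x y hx hy
  | smul c x _ hx => exact smul c x hx

section Multilinear

variable {V : Type*} [AddCommGroup V] [Module ℂ V]

theorem linearMap_mem {a : Z22} (f : Loop Space →ₗ[ℂ] V) (W : Submodule ℂ V)
    (h : ∀ i m, deg i = a → f (X i m) ∈ W) {x : Loop Space} (hx : x ∈ loopGrading a) :
    f x ∈ W :=
  loopGrading_induction (p := fun x => f x ∈ W) h (by simp)
    (fun x y hx hy => by rw [map_add]; exact add_mem hx hy)
    (fun c x hx => by rw [map_smul]; exact W.smul_mem c hx) hx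

theorem bilinear_mem {a b : Z22} (f : Loop Space →ₗ[ℂ] Loop Space →ₗ[ℂ] V) (W : Submodule ℂ V)
    (h : ∀ i m j n, deg i = a → deg j = b → f (X i m) (X j n) ∈ W) {x y : Loop Space}
    (hx : x ∈ loopGrading a) (hy : y ∈ loopGrading b) : f x y ∈ W :=
  linearMap_mem (f.flip y) W (fun i m hi => linearMap_mem (f (X i m)) W
    (fun j n hj => h i m j n hi hj) hy) hx

theorem bilinear_ext {f g : Loop Space →ₗ[ℂ] Loop Space →ₗ[ℂ] V}
    (h : ∀ i m j n, f (X i m) (X j n) = g (X i m) (X j n)) : f = g :=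
  loopBasis.ext fun k => loopBasis.ext fun l => by
    rw [← Prod.mk.eta (p := k), ← Prod.mk.eta (p := l), loopBasis_apply, loopBasis_apply, h]

/-- A bilinear map on the loop algebra is a 2-cocycle as soon as it is one on the basis. -/
theorem isTwoCocycle_of_basis {𝒱 : Z22 → Submodule ℂ V}
    {ω : Loop Space →ₗ[ℂ] Loop Space →ₗ[ℂ] V}
    (degree : ∀ i m j n, ω (X i m) (X j n) ∈ 𝒱 (deg i + deg j))
    (symm : ∀ i m j n, ω (X i m) (X j n) = -((sgn i j : ℂ) • ω (X j n) (X i m)))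
    (cocycle : ∀ i m j n k p,
      (sgn i k : ℂ) • (coeff j k : ℂ) • ω (X i m) (X (target j k) (n + p))
        + (sgn j i : ℂ) • (coeff k i : ℂ) • ω (X j n) (X (target k i) (p + m))
        + (sgn k j : ℂ) • (coeff i j : ℂ) • ω (X k p) (X (target i j) (m + n)) = 0) :
    IsTwoCocycle loopGrading loopBracket 𝒱 ω := by
  refine ⟨?_, ?_, ?_⟩
  · intro a b x hx y hy
    refine bilinear_mem ω _ ?_ hx hy
    rintro i m j n rfl rfl
    exact degree i m j n
  · intro a b x hx y hy
    -- An identity is membership of a difference in `⊥`, so `bilinear_mem` applies.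
    rw [← sub_eq_zero, ← Submodule.mem_bot ℂ]
    refine bilinear_mem (ω - -(Z22.sign a b • ω.flip)) ⊥ ?_ hx hy
    rintro i m j n rfl rfl
    simp [symm i m j n, sign_deg]
  · intro a b c x hx y hy z hz
    rw [← Submodule.mem_bot ℂ]
    refine loopGrading_induction (p := fun x => Z22.sign a c • ω x (loopBracket y z)
      + Z22.sign b a • ω y (loopBracket z x) + Z22.sign c b • ω z (loopBracket x y) ∈ _)
      ?_ ?_ ?_ ?_ hx
    · rintro i m rfl
      -- With the first argument a fixed basis vector, the left side of the cocycle identity is a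
      -- bilinear map of the other two.
      refine bilinear_mem (Z22.sign (deg i) c • loopBracket.compr₂ (ω (X i m))
        + Z22.sign b (deg i) • ω.compl₁₂ LinearMap.id (loopBracket.flip (X i m))
        + Z22.sign c b • (ω.compl₁₂ LinearMap.id (loopBracket (X i m))).flip) ⊥ ?_ hy hz
      rintro j n k p rfl rfl
      simpa [sign_deg, loopBracket_X] using cocycle i m j n k p
    · simp
    · intro x x' h h'
      convert! add_mem h h' using 1
      simp only [map_add, LinearMap.add_apply]
      module
    · intro t x h
      convert! Submodule.smul_mem _ t h using 1
      simp only [map_smul, LinearMap.smul_apply]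
      module

end Multilinear

/-- Apart from the direct sum condition, the axioms say that the bracket is a 2-cocycle with values
in the algebra itself, so the reduction to basis vectors applies to it. -/
theorem isZ22LieSuperalgebra_loop : IsZ22LieSuperalgebra loopGrading loopBracket := by
  have h : IsTwoCocycle loopGrading loopBracket loopGrading loopBracket := by
    refine isTwoCocycle_of_basis ?_ ?_ ?_
    · intro i m j n
      rw [loopBracket_X]
      rcases deg_target i j with h | h
      · simp [h]
      · rw [← h]
        exact Submodule.smul_mem _ _ (X_mem _ _)
    · intro i m j n
      rw [loopBracket_X, loopBracket_X, smul_smul, ← neg_smul, target_comm j i, add_comm n m]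
      congr 1
      exact_mod_cast coeff_symm i j
    · intro i m j n k p
      simp only [loopBracket_X]
      rw [show n + (p + m) = m + (n + p) by ring, show p + (m + n) = m + (n + p) by ring]
      have key (i : Gen) (m : ℤ) :
          X i m = ∑ l, ((if i = l then 1 else 0 : ℤ) : ℂ) • X l m := by simp
      rw [key (target i _), key (target j _), key (target k _)]
      simp only [Finset.smul_sum, ← Finset.sum_add_distrib, smul_smul, ← add_smul]
      refine Finset.sum_eq_zero fun l _ => ?_
      refine (congrArg (· • X l (m + (n + p))) (?_ : _ = (0 : ℂ))).trans (zero_smul ℂ _)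
      have := coeff_jacobi i j k l
      rw [← Int.cast_inj (α := ℂ)] at this
      refine Eq.trans ?_ (this.trans Int.cast_zero)
      push_cast
      ring
  refine ⟨?_, h.degree, h.symm, h.cocycle⟩
  have := loopBasis.isInternal_span fun k => deg k.2
  rwa [show (fun a => Submodule.span ℂ (loopBasis '' {k | deg k.2 = a})) = loopGrading from
    funext fun a => (loopGrading_eq a).symm] at this

/-! ### The cocycles `ω_c`, and normalization by a coboundary. -/

section Cocycles

variable {V : Type*} [AddCommGroup V] [Module ℂ V] {𝒱 : Z22 → Submodule ℂ V}
  {ω : Loop Space →ₗ[ℂ] Loop Space →ₗ[ℂ] V}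

theorem affineCoeff_eq (i j : Gen) (m n : ℤ) :
    affineCoeff i j m n = ((if m + n = 0 then killingCoeff i j * m else 0 : ℤ) : ℂ) := by
  rw [affineCoeff, killing_e]
  split_ifs <;> simp

/-- The cocycle `ω_c(X^i_m, X^j_n) = g^{ij} m δ_{m+n,0} c`. -/
def affineCocycle (c : V) : Loop Space →ₗ[ℂ] Loop Space →ₗ[ℂ] V :=
  loopBasis.constr ℂ fun k => loopBasis.constr ℂ fun l => affineCoeff k.2 l.2 k.1 l.1 • c

theorem affineCocycle_X (c : V) (i j : Gen) (m n : ℤ) :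
    affineCocycle c (X i m) (X j n) = affineCoeff i j m n • c := by
  rw [affineCocycle, ← loopBasis_apply, ← loopBasis_apply, Module.Basis.constr_basis,
    Module.Basis.constr_basis]

theorem isTwoCocycle_affineCocycle {c : V} (hc : c ∈ 𝒱 (0, 0)) :
    IsTwoCocycle loopGrading loopBracket 𝒱 (affineCocycle c) := by
  refine isTwoCocycle_of_basis ?_ ?_ ?_
  · intro i m j n
    rw [affineCocycle_X, affineCoeff_eq]
    rcases deg_of_killingCoeff_ne_zero i j with h | h
    · simp [h]
    · rw [h]
      exact Submodule.smul_mem _ _ hc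
  · intro i m j n
    rw [affineCocycle_X, affineCocycle_X, smul_smul, ← neg_smul]
    congr 1
    simp only [affineCoeff_eq, add_comm n m]
    split_ifs with h
    · rw [eq_neg_of_add_eq_zero_left h, killingCoeff_symm i j]
      push_cast
      ring
    · simp
  · intro i m j n k p
    simp only [affineCocycle_X, smul_smul, ← add_smul]
    refine (congrArg (· • c) (?_ : _ = (0 : ℂ))).trans (zero_smul ℂ _)
    simp only [affineCoeff_eq, show n + (p + m) = m + (n + p) by ring,
      show p + (m + n) = m + (n + p) by ring]
    split_ifs with h
    -- By invariance the factors of `m`, `n` and `p` in the sum agree, and `m + n + p = 0`.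
    · have h1 := killingCoeff_invariant i j k
      have h2 := killingCoeff_invariant j k i
      norm_cast
      rw [show p = -m - n by linarith]
      linear_combination (m + n) * h1 + (m + n) * h2 - n * h1
    · simp

theorem _root_.IsTwoCocycle.basis_symm (h : IsTwoCocycle loopGrading loopBracket 𝒱 ω)
    (i j : Gen) (m n : ℤ) : ω (X i m) (X j n) = -((sgn i j : ℂ) • ω (X j n) (X i m)) := by
  rw [← sign_deg]
  exact h.symm _ _ _ (X_mem i m) _ (X_mem j n)

theorem _root_.IsTwoCocycle.basis_cocycle (h : IsTwoCocycle loopGrading loopBracket 𝒱 ω)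
    (i j k : Gen) (m n p : ℤ) :
    ((sgn i k * coeff j k : ℤ) : ℂ) • ω (X i m) (X (target j k) (n + p))
      + ((sgn j i * coeff k i : ℤ) : ℂ) • ω (X j n) (X (target k i) (p + m))
      + ((sgn k j * coeff i j : ℤ) : ℂ) • ω (X k p) (X (target i j) (m + n)) = 0 := by
  have := h.cocycle _ _ _ _ (X_mem i m) _ (X_mem j n) _ (X_mem k p)
  simpa only [sign_deg, loopBracket_X, map_smul, smul_smul, Int.cast_mul] using this

/-- The eigenvalues of `ad R`. -/
def weight : Gen → ℤ
  | Lp => 2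
  | Lm => -2
  | R | Rt => 0
  | ap | atp => 1
  | am | atm => -1

/-- A cocycle which vanishes on those pairs on which one can achieve this by subtracting a
coboundary. -/
structure IsNormalized (ω : Loop Space →ₗ[ℂ] Loop Space →ₗ[ℂ] V) : Prop where
  R_weight : ∀ i m, weight i ≠ 0 → ω (X R 0) (X i m) = 0
  Lp_Lm : ∀ m, ω (X Lp 0) (X Lm m) = 0
  ap_atm : ∀ m, ω (X ap 0) (X atm m) = 0

/-- The linear map whose coboundary normalizes `ω`. -/
def normalizer (ω : Loop Space →ₗ[ℂ] Loop Space →ₗ[ℂ] V) : Loop Space →ₗ[ℂ] V :=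
  loopBasis.constr ℂ fun k => match k.2 with
    -- The factors invert `[L⁺_0, L⁻_m] = -R_m`, `[a⁺_0, ã⁻_m] = 2 R̃_m` and `[R_0, X^i_m] = weight
    -- i • X^i_m`, so that the coboundary agrees with ω on these pairs.
    | R => -ω (X Lp 0) (X Lm k.1)
    | Rt => (2⁻¹ : ℂ) • ω (X ap 0) (X atm k.1)
    | i => (weight i : ℂ)⁻¹ • ω (X R 0) (X i k.1)

theorem normalizer_X (i : Gen) (m : ℤ) : normalizer ω (X i m) = match i with
    | R => -ω (X Lp 0) (X Lm m)
    | Rt => (2⁻¹ : ℂ) • ω (X ap 0) (X atm m)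
    | i => (weight i : ℂ)⁻¹ • ω (X R 0) (X i m) := by
  rw [normalizer, ← loopBasis_apply m i, Module.Basis.constr_basis]

theorem isDegreePreserving_normalizer (h : IsTwoCocycle loopGrading loopBracket 𝒱 ω) :
    IsDegreePreserving loopGrading 𝒱 (normalizer ω) := by
  intro a x hx
  refine linearMap_mem _ _ ?_ hx
  rintro i m rfl
  have key (j k : Gen) (hjk : deg j + deg k = deg i) (m n : ℤ) :
      ω (X j m) (X k n) ∈ 𝒱 (deg i) := by
    rw [← hjk]
    exact h.degree _ _ _ (X_mem j m) _ (X_mem k n)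
  rw [normalizer_X]
  cases i
  case R => exact neg_mem (key _ _ rfl _ _)
  all_goals exact Submodule.smul_mem _ _ (key _ _ (by decide) _ _)

theorem isTwoCocycle_coboundary {f : Loop Space →ₗ[ℂ] V}
    (hf : IsDegreePreserving loopGrading 𝒱 f) :
    IsTwoCocycle loopGrading loopBracket 𝒱 (loopBracket.compr₂ f) := by
  have h := isZ22LieSuperalgebra_loop
  refine ⟨?_, ?_, ?_⟩
  · intro a b x hx y hy
    exact hf _ _ (h.bracket_mem a b x hx y hy)
  · intro a b x hx y hy
    rw [LinearMap.compr₂_apply, h.bracket_symm a b x hx y hy]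
    simp
  · intro a b c x hx y hy z hz
    simpa only [LinearMap.compr₂_apply, map_add, map_smul, map_zero]
      using congrArg f (h.jacobi a b c x hx y hy z hz)

theorem _root_.IsTwoCocycle.sub {ω' : Loop Space →ₗ[ℂ] Loop Space →ₗ[ℂ] V}
    (h : IsTwoCocycle loopGrading loopBracket 𝒱 ω)
    (h' : IsTwoCocycle loopGrading loopBracket 𝒱 ω') :
    IsTwoCocycle loopGrading loopBracket 𝒱 (ω - ω') := by
  refine ⟨?_, ?_, ?_⟩
  · intro a b x hx y hy
    exact sub_mem (h.degree a b x hx y hy) (h'.degree a b x hx y hy)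
  · intro a b x hx y hy
    simp only [LinearMap.sub_apply]
    rw [h.symm a b x hx y hy, h'.symm a b x hx y hy]
    module
  · intro a b c x hx y hy z hz
    simp only [LinearMap.sub_apply]
    linear_combination (norm := module) h.cocycle a b c x hx y hy z hz
      - h'.cocycle a b c x hx y hy z hz

theorem isNormalized_sub_coboundary :
    IsNormalized (ω - loopBracket.compr₂ (normalizer ω)) := by
  refine ⟨?_, ?_, ?_⟩
  · intro i m hi
    simp only [LinearMap.sub_apply, LinearMap.compr₂_apply, loopBracket_X, map_smul, zero_add]
    cases i <;> simp [weight, coeff, target, normalizer_X] at hi ⊢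
  · intro m
    simp [loopBracket_X, coeff, target, normalizer_X]
  · intro m
    simp [loopBracket_X, coeff, target, normalizer_X]

end Cocycles

/-! ### Classification of normalized cocycles. -/

section Normalized

variable {V : Type*} [AddCommGroup V] [Module ℂ V] {𝒱 : Z22 → Submodule ℂ V}
  {ω : Loop Space →ₗ[ℂ] Loop Space →ₗ[ℂ] V}

theorem coeff_R (i : Gen) :
    coeff R i = weight i ∧ coeff i R = -weight i ∧ sgn i R = 1 ∧ sgn R i = 1 := by
  revert i; decide

theorem target_R (i : Gen) : weight i = 0 ∨ (target R i = i ∧ target i R = i) := by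
  revert i; decide

theorem weight_target (i j : Gen) : coeff i j = 0 ∨ weight (target i j) = weight i + weight j := by
  revert i j; decide

/-- In the cocycle identity for `R_0, x, y` the term `ω(R_0, [x, y])` vanishes by normalization,
`[x, y]` having nonzero weight; the other two add up to a multiple of `ω(x, y)` by minus the total
weight. -/
theorem IsNormalized.eq_zero_of_weight (hn : IsNormalized ω)
    (h : IsTwoCocycle loopGrading loopBracket 𝒱 ω) {i j : Gen} (hij : weight i + weight j ≠ 0)
    (m n : ℤ) : ω (X i m) (X j n) = 0 := by
  have key := h.basis_cocycle R i j 0 m n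
  have h1 : ((sgn R j * coeff i j : ℤ) : ℂ) • ω (X R 0) (X (target i j) (m + n)) = 0 := by
    rcases weight_target i j with h0 | h0
    · simp [h0]
    · rw [hn.R_weight _ _ (h0 ▸ hij), smul_zero]
  have h2 : ((sgn i R * coeff j R : ℤ) : ℂ) • ω (X i m) (X (target j R) (n + 0))
      = -(weight j : ℂ) • ω (X i m) (X j n) := by
    rw [(coeff_R i).2.2.1, (coeff_R j).2.1, add_zero]
    rcases target_R j with h0 | h0
    · simp [h0]
    · simp [h0.2]
  have h3 : ((sgn j i * coeff R i : ℤ) : ℂ) • ω (X j n) (X (target R i) (0 + m))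
      = -(weight i : ℂ) • ω (X i m) (X j n) := by
    rw [(coeff_R i).1, zero_add, h.basis_symm i j]
    have hs : (sgn j i : ℂ) = sgn i j := by rw [← sign_deg, ← sign_deg, Z22.sign_comm]
    rcases target_R i with h0 | h0
    · simp [h0]
    · rw [h0.1, Int.cast_mul, hs]
      module
  rw [h1, h2, h3] at key
  have : ((weight i + weight j : ℤ) : ℂ) • ω (X i m) (X j n) = 0 := by
    push_cast
    linear_combination (norm := module) (-1 : ℂ) • key
  exact (smul_eq_zero.mp this).resolve_left (by exact_mod_cast hij)

theorem IsNormalized.apply_Lp_Lm (hn : IsNormalized ω)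
    (h : IsTwoCocycle loopGrading loopBracket 𝒱 ω) (m n : ℤ) :
    ω (X Lp m) (X Lm n) = (-2⁻¹ : ℂ) • ω (X R m) (X R n) := by
  have key := h.basis_cocycle R Lp Lm m 0 n
  have hs := h.basis_symm Lm Lp n m
  simp [sgn, Z22.dot, deg, coeff, target, hn.Lp_Lm] at key hs
  rw [hs] at key
  linear_combination (norm := module) (-2⁻¹ : ℂ) • key

/-- The identity for `R_p, L⁺_m, L⁻_n`, with the `L⁺, L⁻` values rewritten through `φ(m, n) = ω(R_m,
R_n)`. At `p = m = 0` it gives `φ(0, n) = 0`. -/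
theorem IsNormalized.apply_R_R_cyclic (hn : IsNormalized ω)
    (h : IsTwoCocycle loopGrading loopBracket 𝒱 ω) (m n p : ℤ) :
    ω (X R (p + m)) (X R n) = ω (X R p) (X R (m + n)) + ω (X R m) (X R (n + p)) := by
  have key := h.basis_cocycle R Lp Lm p m n
  have hs := h.basis_symm Lm Lp n (p + m)
  simp [sgn, Z22.dot, deg, coeff, target, hn.apply_Lp_Lm h] at key hs
  rw [hs] at key
  linear_combination (norm := module) key

theorem IsNormalized.apply_R_zero (hn : IsNormalized ω)
    (h : IsTwoCocycle loopGrading loopBracket 𝒱 ω) (n : ℤ) : ω (X R 0) (X R n) = 0 := by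
  simpa using hn.apply_R_R_cyclic h 0 n 0

/-- Taking one index equal to 1 in the cyclic relation shifts `m` by one at constant `m + n`, each
shift contributing one copy of `φ(1, m+n-1)`. -/
theorem IsNormalized.apply_R_R_eq_smul (hn : IsNormalized ω)
    (h : IsTwoCocycle loopGrading loopBracket 𝒱 ω) (m n : ℤ) :
    ω (X R m) (X R n) = (m : ℂ) • ω (X R 1) (X R (m + n - 1)) := by
  induction m generalizing n with
  | zero => simp [hn.apply_R_zero h]
  | succ m ih =>
    have h1 := hn.apply_R_R_cyclic h m n 1
    have h2 := ih (n + 1)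
    rw [show (m : ℤ) + (n + 1) - 1 = m + n by ring] at h2
    rw [show (m : ℤ) + 1 + n - 1 = m + n by ring, add_comm (m : ℤ) 1, h1, h2]
    push_cast
    module
  | pred m ih =>
    have h1 := hn.apply_R_R_cyclic h (-m - 1) (n - 1) 1
    have h2 := ih (n - 1)
    rw [show (1 : ℤ) + (-m - 1) = -m by ring, h2, show n - 1 + 1 = n by ring,
      show (-m - 1 + (n - 1) : ℤ) = -m + (n - 1) - 1 by ring] at h1
    rw [show (-m - 1 + n - 1 : ℤ) = -m + (n - 1) - 1 by ring]
    push_cast at h1 ⊢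
    linear_combination (norm := module) -h1

theorem IsNormalized.apply_R_R (hn : IsNormalized ω)
    (h : IsTwoCocycle loopGrading loopBracket 𝒱 ω) (m n : ℤ) :
    ω (X R m) (X R n) = if m + n = 0 then (m : ℂ) • ω (X R 1) (X R (-1)) else 0 := by
  have h1 := hn.apply_R_R_eq_smul h m n
  split_ifs with hmn
  · rw [h1, hmn]
    rfl
  · have h2 := hn.apply_R_R_eq_smul h n m
    have hs := h.basis_symm R R m n
    simp [sgn, Z22.dot, deg] at hs
    rw [add_comm n m] at h2
    rw [h1, h2] at hs
    -- Skew-symmetry applied to `φ(m, n) = m φ(1, m+n-1)` and `φ(n, m) = n φ(1, m+n-1)`.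
    have : ((m + n : ℤ) : ℂ) • ω (X R 1) (X R (m + n - 1)) = 0 := by
      push_cast
      linear_combination (norm := module) hs
    rw [h1, (smul_eq_zero.mp this).resolve_left (by exact_mod_cast hmn), smul_zero]

theorem _root_.IsTwoCocycle.apply_R_R_symm (h : IsTwoCocycle loopGrading loopBracket 𝒱 ω)
    (m n : ℤ) :
    ω (X R m) (X R n) = -ω (X R n) (X R m) := by
  simpa [sgn, Z22.dot, deg] using h.basis_symm R R m n

/-- `R` is a multiple of `[L⁺, L⁻]` and `R̃` commutes with `L±`; no normalization is involved. -/
theorem _root_.IsTwoCocycle.apply_R_Rt (h : IsTwoCocycle loopGrading loopBracket 𝒱 ω)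
    (m n : ℤ) : ω (X R m) (X Rt n) = 0 := by
  have key := h.basis_cocycle Lp Lm Rt m 0 n
  have hs := h.basis_symm R Rt m n
  simp [sgn, Z22.dot, deg, coeff, target] at key hs
  rw [hs, key, neg_zero]

theorem IsNormalized.apply_ap_atm (hn : IsNormalized ω)
    (h : IsTwoCocycle loopGrading loopBracket 𝒱 ω) (m n : ℤ) : ω (X ap m) (X atm n) = 0 := by
  have key := h.basis_cocycle R ap atm m 0 n
  have hs := h.basis_symm ap atm m n
  simp [sgn, Z22.dot, deg, coeff, target, h.apply_R_Rt, hn.ap_atm] at key hs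
  rw [hs, key, neg_zero]

theorem IsNormalized.apply_am_atp (hn : IsNormalized ω)
    (h : IsTwoCocycle loopGrading loopBracket 𝒱 ω) (m n : ℤ) : ω (X am m) (X atp n) = 0 := by
  have key := h.basis_cocycle Lp am atm 0 m n
  have hs := h.basis_symm atm ap n m
  simp [sgn, Z22.dot, deg, coeff, target, hn.apply_ap_atm h] at key hs
  simpa [hs] using key

/-- Put `B(m, n) = ω(a⁺_m, a⁻_n)`. The triple `R_m, a⁺_0, a⁻_n` gives `B(m, n) - 2φ(m, n) = B(0,
m+n)`, symmetric in `m, n`. The triple `L⁺_0, a⁻, a⁻` makes `B` skew, since `ω(L⁺_0, L⁻_k) = 0`. So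
`B - 2φ` is both symmetric and skew. -/
theorem IsNormalized.apply_ap_am (hn : IsNormalized ω)
    (h : IsTwoCocycle loopGrading loopBracket 𝒱 ω) (m n : ℤ) :
    ω (X ap m) (X am n) = (2 : ℂ) • ω (X R m) (X R n) := by
  have key (m n : ℤ) := h.basis_cocycle R ap am m 0 n
  have key' (m n : ℤ) := h.basis_cocycle Lp am am 0 m n
  have hs (m n : ℤ) := h.basis_symm am ap n m
  simp [sgn, Z22.dot, deg, coeff, target, hn.apply_Lp_Lm h, hn.apply_R_zero h] at key key' hs
  have h1 := key m n
  have h2 := key n m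
  have h3 := key' n m
  have h4 := h.apply_R_R_symm m n
  rw [hs] at h1 h2 h3
  rw [hs] at h3
  rw [add_comm n m] at h1
  linear_combination (norm := module) (-2⁻¹ : ℂ) • h1 + (2⁻¹ : ℂ) • h2 + (2⁻¹ : ℂ) • h3 - h4

theorem IsNormalized.apply_atp_atm (hn : IsNormalized ω)
    (h : IsTwoCocycle loopGrading loopBracket 𝒱 ω) (m n : ℤ) :
    ω (X atp m) (X atm n) = (2 : ℂ) • ω (X R m) (X R n) := by
  have key (m n : ℤ) := h.basis_cocycle R atp atm m 0 n
  have key' (m n : ℤ) := h.basis_cocycle Lp atm atm 0 m n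
  have hs (m n : ℤ) := h.basis_symm atm atp n m
  simp [sgn, Z22.dot, deg, coeff, target, hn.apply_Lp_Lm h, hn.apply_R_zero h] at key key' hs
  have h1 := key m n
  have h2 := key n m
  have h3 := key' n m
  have h4 := h.apply_R_R_symm m n
  rw [hs] at h1 h2 h3
  rw [hs] at h3
  rw [add_comm n m] at h1
  linear_combination (norm := module) (-2⁻¹ : ℂ) • h1 + (2⁻¹ : ℂ) • h2 - (2⁻¹ : ℂ) • h3 - h4

/-- The triple `R̃_m, a⁺_0, ã⁻_n` relates this value to `ω(ã⁺_m, ã⁻_n)`, the `a⁺, a⁻` term being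
`2φ(0, m+n) = 0`. -/
theorem IsNormalized.apply_Rt_Rt (hn : IsNormalized ω)
    (h : IsTwoCocycle loopGrading loopBracket 𝒱 ω) (m n : ℤ) :
    ω (X Rt m) (X Rt n) = ω (X R m) (X R n) := by
  have key := h.basis_cocycle Rt ap atm m 0 n
  have hs := h.basis_symm atm atp n m
  simp [sgn, Z22.dot, deg, coeff, target, hn.apply_ap_am h, hn.apply_atp_atm h,
    hn.apply_R_zero h] at key hs
  rw [hs] at key
  linear_combination (norm := module) (-2⁻¹ : ℂ) • key

theorem IsNormalized.apply_X_X (hn : IsNormalized ω)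
    (h : IsTwoCocycle loopGrading loopBracket 𝒱 ω) (i j : Gen) (m n : ℤ) :
    ω (X i m) (X j n) = (killingCoeff i j / 4 : ℂ) • ω (X R m) (X R n) := by
  -- Exchanging the arguments multiplies ω by `-sgn`, the Killing form by `sgn` and φ by `-1`, so
  -- one order of each pair suffices.
  have swap {i j : Gen} (hij : ∀ m n, ω (X j n) (X i m)
      = (killingCoeff j i / 4 : ℂ) • ω (X R n) (X R m)) (m n : ℤ) :
      ω (X i m) (X j n) = (killingCoeff i j / 4 : ℂ) • ω (X R m) (X R n) := by
    rw [h.basis_symm, hij, h.apply_R_R_symm m n, killingCoeff_symm i j]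
    push_cast
    module
  have hR (m n) : ω (X R m) (X R n) = (killingCoeff R R / 4 : ℂ) • ω (X R m) (X R n) := by
    norm_num [killingCoeff]
  have hRRt (m n) : ω (X R m) (X Rt n) = (killingCoeff R Rt / 4 : ℂ) • ω (X R m) (X R n) := by
    simp [killingCoeff, h.apply_R_Rt]
  have hRt (m n) : ω (X Rt m) (X Rt n) = (killingCoeff Rt Rt / 4 : ℂ) • ω (X R m) (X R n) := by
    norm_num [killingCoeff, hn.apply_Rt_Rt h]
  have hL (m n) : ω (X Lp m) (X Lm n) = (killingCoeff Lp Lm / 4 : ℂ) • ω (X R m) (X R n) := by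
    norm_num [killingCoeff, hn.apply_Lp_Lm h]
  have ha (m n) : ω (X ap m) (X am n) = (killingCoeff ap am / 4 : ℂ) • ω (X R m) (X R n) := by
    norm_num [killingCoeff, hn.apply_ap_am h]
  have hat (m n) : ω (X atp m) (X atm n)
      = (killingCoeff atp atm / 4 : ℂ) • ω (X R m) (X R n) := by
    norm_num [killingCoeff, hn.apply_atp_atm h]
  have h1 (m n) : ω (X ap m) (X atm n) = (killingCoeff ap atm / 4 : ℂ) • ω (X R m) (X R n) := by
    simp [killingCoeff, hn.apply_ap_atm h]
  have h2 (m n) : ω (X am m) (X atp n) = (killingCoeff am atp / 4 : ℂ) • ω (X R m) (X R n) := by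
    simp [killingCoeff, hn.apply_am_atp h]
  by_cases hw : weight i + weight j = 0
  · cases i <;> cases j <;> first
      | (exfalso; revert hw; decide)
      | apply hR | apply hRRt | apply hRt | apply hL | apply ha | apply hat | apply h1 | apply h2
      | (apply swap; first
        | exact fun m n => hRRt n m | exact fun m n => hL n m | exact fun m n => ha n m
        | exact fun m n => hat n m | exact fun m n => h1 n m | exact fun m n => h2 n m)
  · have hk : ∀ i j : Gen, weight i + weight j ≠ 0 → killingCoeff i j = 0 := by decide
    simp [hn.eq_zero_of_weight h hw, hk i j hw]

/-- A normalized cocycle is of the form `ω_c`. -/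
theorem IsNormalized.eq_affineCocycle (hn : IsNormalized ω)
    (h : IsTwoCocycle loopGrading loopBracket 𝒱 ω) :
    ω = affineCocycle ((4⁻¹ : ℂ) • ω (X R 1) (X R (-1))) := by
  refine bilinear_ext fun i m j n => ?_
  rw [affineCocycle_X, hn.apply_X_X h, hn.apply_R_R h, affineCoeff_eq]
  split_ifs
  · push_cast
    module
  · simp

/-- Every cocycle is cohomologous to some `ω_c`. -/
theorem _root_.IsTwoCocycle.exists_affineCocycle (h : IsTwoCocycle loopGrading loopBracket 𝒱 ω) :
    ∃ c ∈ 𝒱 (0, 0), IsTwoCoboundary loopGrading loopBracket 𝒱 (ω - affineCocycle c) := by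
  have hf := isDegreePreserving_normalizer h
  have h' := h.sub (isTwoCocycle_coboundary hf)
  -- The witness is a quarter of the normalized cocycle at `(R_1, R_{-1})`, because `g^{RR} = 4`.
  refine ⟨_, Submodule.smul_mem _ (4⁻¹ : ℂ) (h'.degree _ _ _ (X_mem R 1) _ (X_mem R (-1))),
    normalizer ω, hf, fun x y => ?_⟩
  rw [← isNormalized_sub_coboundary.eq_affineCocycle h']
  simp

end Normalized

/-! ### Uniqueness of `c`, and central extensions. -/

theorem affineCoeff_R_R : affineCoeff R R 1 (-1) = 4 := by
  norm_num [affineCoeff_eq, killingCoeff]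

theorem loopBracket_R_R (m n : ℤ) : loopBracket (X R m) (X R n) = 0 := by
  simp [loopBracket_X, coeff]

section Extensions

variable {V E : Type*} [AddCommGroup V] [Module ℂ V] {𝒱 : Z22 → Submodule ℂ V}
  [AddCommGroup E] [Module ℂ E] {𝓔 : Z22 → Submodule ℂ E}
  {ω : Loop Space →ₗ[ℂ] Loop Space →ₗ[ℂ] V} {brE : E →ₗ[ℂ] E →ₗ[ℂ] E} {π : E →ₗ[ℂ] Loop Space}

theorem _root_.IsTwoCocycle.existsUnique (h : IsTwoCocycle loopGrading loopBracket 𝒱 ω) :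
    ∃! c : V, c ∈ 𝒱 (0, 0) ∧ ∃ ω' : Loop Space →ₗ[ℂ] Loop Space →ₗ[ℂ] V,
      (∀ (i j : Gen) (m n : ℤ), ω' (X i m) (X j n) = affineCoeff i j m n • c) ∧
      IsTwoCoboundary loopGrading loopBracket 𝒱 (ω - ω') := by
  obtain ⟨c, hc, hω⟩ := h.exists_affineCocycle
  have key (c : V) (ω' : Loop Space →ₗ[ℂ] Loop Space →ₗ[ℂ] V)
      (hω' : ∀ (i j : Gen) (m n : ℤ), ω' (X i m) (X j n) = affineCoeff i j m n • c)
      (hb : IsTwoCoboundary loopGrading loopBracket 𝒱 (ω - ω')) :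
      (4 : ℂ) • c = ω (X R 1) (X R (-1)) := by
    obtain ⟨f, -, hf⟩ := hb
    have := hf (X R 1) (X R (-1))
    rw [loopBracket_R_R, map_zero, LinearMap.sub_apply, LinearMap.sub_apply, hω',
      affineCoeff_R_R, sub_eq_zero] at this
    exact this.symm
  refine ⟨c, ⟨hc, affineCocycle c, fun i j m n => affineCocycle_X c i j m n, hω⟩, ?_⟩
  rintro c' ⟨-, ω', hω', hb⟩
  have := (key c' ω' hω' hb).trans (key c _ (fun i j m n => affineCocycle_X c i j m n) hω).symm
  exact smul_right_injective V (by norm_num : (4 : ℂ) ≠ 0) this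

/-- A cocycle defines a central extension. -/
theorem _root_.IsTwoCocycle.isCentralExtension (h𝒱 : DirectSum.IsInternal 𝒱)
    (h : IsTwoCocycle loopGrading loopBracket 𝒱 ω) :
    IsCentralExtension loopGrading loopBracket (prodGrading loopGrading 𝒱)
      (extBracket loopBracket ω) (LinearMap.fst ℂ (Loop Space) V) := by
  have hL := isZ22LieSuperalgebra_loop
  have key (x y : Loop Space × V) :
      extBracket loopBracket ω x y = (loopBracket x.1 y.1, ω x.1 y.1) := by
    simp [extBracket]
  refine ⟨⟨isInternal_prodGrading hL.isInternal h𝒱, ?_, ?_, ?_⟩, ?_, ?_, ?_, ?_⟩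
  · intro a b x hx y hy
    rw [key]
    exact ⟨hL.bracket_mem a b _ hx.1 _ hy.1, h.degree a b _ hx.1 _ hy.1⟩
  · intro a b x hx y hy
    rw [key, key]
    exact Prod.ext (hL.bracket_symm a b _ hx.1 _ hy.1) (h.symm a b _ hx.1 _ hy.1)
  · intro a b c x hx y hy z hz
    simp only [key]
    exact Prod.ext (hL.jacobi a b c _ hx.1 _ hy.1 _ hz.1) (h.cocycle a b c _ hx.1 _ hy.1 _ hz.1)
  · intro a x hx
    exact hx.1
  · intro x y
    rw [key]
    rfl
  · exact LinearMap.fst_surjective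
  · intro z hz x
    rw [key, show z.1 = 0 from hz, map_zero, map_zero]
    rfl

/-- A preimage of a basis vector stays a preimage after projection to the degree of that vector,
because π commutes with the homogeneous projections. -/
theorem _root_.IsCentralExtension.exists_section
    (h : IsCentralExtension loopGrading loopBracket 𝓔 brE π) :
    ∃ s : Loop Space →ₗ[ℂ] E, IsDegreePreserving loopGrading 𝓔 s ∧ ∀ x, π (s x) = x := by
  obtain ⟨p, hp⟩ := h.isLie.isInternal.exists_isGradedProjection
  obtain ⟨q, hq⟩ := isZ22LieSuperalgebra_loop.isInternal.exists_isGradedProjection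
  have lift (k : ℤ × Gen) : ∃ z ∈ 𝓔 (deg k.2), π z = X k.2 k.1 := by
    obtain ⟨z, hz⟩ := h.surjective (X k.2 k.1)
    refine ⟨p (deg k.2) z, hp.mem _ _, ?_⟩
    rw [hp.map_apply hq h.degree, hz, hq.apply_same _ _ (X_mem _ _)]
  choose t ht hπ using lift
  have hs (i : Gen) (m : ℤ) : loopBasis.constr ℂ t (X i m) = t (m, i) := by
    rw [← loopBasis_apply, Module.Basis.constr_basis]
  refine ⟨loopBasis.constr ℂ t, ?_, ?_⟩
  · intro a x hx
    refine linearMap_mem _ _ ?_ hx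
    rintro i m rfl
    rw [hs]
    exact ht (m, i)
  · intro x
    rw [← LinearMap.comp_apply]
    conv_rhs => rw [← LinearMap.id_apply (R := ℂ) x]
    congr 1
    refine loopBasis.ext fun k => ?_
    rw [← Prod.mk.eta (p := k), loopBasis_apply, LinearMap.comp_apply, hs, hπ]
    rfl

/-- Homogeneous elements of the kernel are annihilated by homogeneous elements from either
side. -/
theorem _root_.IsCentralExtension.bracket_eq_zero
    (h : IsCentralExtension loopGrading loopBracket 𝓔 brE π) {a b : Z22} {z x : E}
    (hz : z ∈ 𝓔 a) (hπ : π z = 0) (hx : x ∈ 𝓔 b) : brE z x = 0 := by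
  rw [h.isLie.bracket_symm a b z hz x hx, h.central z hπ, smul_zero, neg_zero]

/-- The cocycle `ω(x, y) = [s(x), s(y)] - s([x, y])` of a section `s`. -/
def sectionCocycle (brE : E →ₗ[ℂ] E →ₗ[ℂ] E) (s : Loop Space →ₗ[ℂ] E) :
    Loop Space →ₗ[ℂ] Loop Space →ₗ[ℂ] E :=
  brE.compl₁₂ s s - loopBracket.compr₂ s

theorem sectionCocycle_apply (s : Loop Space →ₗ[ℂ] E) (x y : Loop Space) :
    sectionCocycle brE s x y = brE (s x) (s y) - s (loopBracket x y) := rfl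

theorem _root_.IsCentralExtension.isTwoCocycle_sectionCocycle
    (h : IsCentralExtension loopGrading loopBracket 𝓔 brE π) {s : Loop Space →ₗ[ℂ] E}
    (hs : IsDegreePreserving loopGrading 𝓔 s) (hπ : ∀ x, π (s x) = x) :
    IsTwoCocycle loopGrading loopBracket (fun a => 𝓔 a ⊓ LinearMap.ker π)
      (sectionCocycle brE s) := by
  have hL := isZ22LieSuperalgebra_loop
  have hker (x y : Loop Space) : π (sectionCocycle brE s x y) = 0 := by
    rw [sectionCocycle_apply, map_sub, h.hom, hπ, hπ, hπ, sub_self]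
  refine ⟨?_, ?_, ?_⟩
  · intro a b x hx y hy
    exact ⟨sub_mem (h.isLie.bracket_mem a b _ (hs a x hx) _ (hs b y hy))
      (hs _ _ (hL.bracket_mem a b x hx y hy)), hker x y⟩
  · intro a b x hx y hy
    rw [sectionCocycle_apply, sectionCocycle_apply,
      h.isLie.bracket_symm a b _ (hs a x hx) _ (hs b y hy), hL.bracket_symm a b x hx y hy, map_neg,
      map_smul]
    module
  · intro a b c x hx y hy z hz
    have hE := h.isLie.jacobi a b c _ (hs a x hx) _ (hs b y hy) _ (hs c z hz)
    have hJ := congrArg s (hL.jacobi a b c x hx y hy z hz)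
    simp only [map_add, map_smul, map_zero] at hJ
    -- Centrality gives `[s x, s [y, z]] = [s x, [s y, s z]]`, so the cocycle identity is the
    -- difference of the Jacobi identities of the two algebras.
    have key (x y z : Loop Space) : sectionCocycle brE s x (loopBracket y z)
        = brE (s x) (brE (s y) (s z)) - s (loopBracket x (loopBracket y z)) := by
      have := h.central _ (hker y z) (s x)
      rw [sectionCocycle_apply, map_sub, sub_eq_zero] at this
      rw [sectionCocycle_apply, this]
    rw [key, key, key]
    linear_combination (norm := module) hE - hJ

theorem _root_.IsCentralExtension.existsUnique
    (h : IsCentralExtension loopGrading loopBracket 𝓔 brE π) :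
    ∃! c : E, c ∈ 𝓔 (0, 0) ∧ π c = 0 ∧ ∃ s : Loop Space →ₗ[ℂ] E,
      IsDegreePreserving loopGrading 𝓔 s ∧ (∀ x : Loop Space, π (s x) = x) ∧
      ∀ (i j : Gen) (m n : ℤ), brE (s (X i m)) (s (X j n))
        = s (loopBracket (X i m) (X j n)) + affineCoeff i j m n • c := by
  -- two sections give the same brackets of homogeneous elements
  have key {s t : Loop Space →ₗ[ℂ] E} (hs : IsDegreePreserving loopGrading 𝓔 s)
      (hsπ : ∀ x, π (s x) = x) (ht : IsDegreePreserving loopGrading 𝓔 t)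
      (htπ : ∀ x, π (t x) = x) (i j : Gen) (m n : ℤ) :
      brE (s (X i m)) (s (X j n)) = brE (t (X i m)) (t (X j n)) := by
    have h1 : brE (s (X i m) - t (X i m)) (s (X j n)) = 0 :=
      h.bracket_eq_zero (sub_mem (hs _ _ (X_mem i m)) (ht _ _ (X_mem i m)))
        (by rw [map_sub, hsπ, htπ, sub_self]) (hs _ _ (X_mem j n))
    have h2 : brE (t (X i m)) (s (X j n) - t (X j n)) = 0 :=
      h.central _ (by rw [map_sub, hsπ, htπ, sub_self]) _
    rw [map_sub, LinearMap.sub_apply, sub_eq_zero] at h1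
    rw [map_sub, sub_eq_zero] at h2
    rw [h1, h2]
  obtain ⟨s, hs, hsπ⟩ := h.exists_section
  -- Taking the family `𝓔 a ⊓ ker π` as target puts both `c` and the values of `f` into the kernel.
  obtain ⟨c, hc, f, hf, hfω⟩ := (h.isTwoCocycle_sectionCocycle hs hsπ).exists_affineCocycle
  have hπf (x : Loop Space) : π (f x) = 0 := by
    have : π ∘ₗ f = 0 := loopBasis.ext fun k => by
      rw [← Prod.mk.eta (p := k), loopBasis_apply]
      exact (hf _ _ (X_mem k.2 k.1)).2
    exact LinearMap.congr_fun this x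
  have ht : IsDegreePreserving loopGrading 𝓔 (s + f) :=
    fun a x hx => add_mem (hs a x hx) (hf a x hx).1
  have htπ (x : Loop Space) : π ((s + f) x) = x := by
    rw [LinearMap.add_apply, map_add, hsπ, hπf, add_zero]
  refine ⟨c, ⟨hc.1, hc.2, s + f, ht, htπ, ?_⟩, ?_⟩
  · intro i j m n
    have := hfω (X i m) (X j n)
    rw [LinearMap.sub_apply, LinearMap.sub_apply, sectionCocycle_apply, affineCocycle_X] at this
    -- Passing from `s` to `s + f` leaves the brackets unchanged, while `f([x, y])` absorbs the
    -- coboundary.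
    rw [key ht htπ hs hsπ, LinearMap.add_apply, ← this]
    abel
  · rintro c' ⟨-, -, t, ht, htπ, hbr⟩
    have h1 := hfω (X R 1) (X R (-1))
    have h2 := hbr R R 1 (-1)
    rw [LinearMap.sub_apply, LinearMap.sub_apply, sectionCocycle_apply, affineCocycle_X,
      loopBracket_R_R, map_zero, map_zero, sub_zero, sub_eq_zero] at h1
    rw [key ht htπ hs hsπ, h1, loopBracket_R_R, map_zero, zero_add, affineCoeff_R_R] at h2
    exact (smul_right_injective E (by norm_num : (4 : ℂ) ≠ 0) h2).symm

end Extensions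

end G8

end

theorem mainTheorem2 :
    -- the loop algebra `L(𝔤⁸)` is a `ℤ₂²`-graded Lie superalgebra
    IsZ22LieSuperalgebra G8.loopGrading G8.loopBracket ∧
    -- 2-cocycles with values in an arbitrary graded space `V`
    (∀ (V : Type*) [AddCommGroup V] [Module ℂ V] (𝒱 : Z22 → Submodule ℂ V),
      DirectSum.IsInternal 𝒱 →
      -- up to a coboundary, each of them is `ω(X^i_m, X^j_n) = g^{ij} m δ_{m+n,0} c`,
      -- with a unique central element `c`, of degree `(0,0)`
      (∀ ω : Loop G8.Space →ₗ[ℂ] Loop G8.Space →ₗ[ℂ] V,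
        IsTwoCocycle G8.loopGrading G8.loopBracket 𝒱 ω →
        ∃! c : V, c ∈ 𝒱 (0, 0) ∧
          ∃ ω' : Loop G8.Space →ₗ[ℂ] Loop G8.Space →ₗ[ℂ] V,
            (∀ (i j : G8.Gen) (m n : ℤ),
              ω' (G8.X i m) (G8.X j n) = G8.affineCoeff i j m n • c) ∧
            IsTwoCoboundary G8.loopGrading G8.loopBracket 𝒱 (ω - ω')) ∧
      -- each `c` of degree `(0,0)` occurs: the formula defines a 2-cocycle and hence a
      -- central extension `L(𝔤⁸) ⊕ V`
      (∀ c ∈ 𝒱 (0, 0),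
        ∃ ω' : Loop G8.Space →ₗ[ℂ] Loop G8.Space →ₗ[ℂ] V,
          (∀ (i j : G8.Gen) (m n : ℤ),
            ω' (G8.X i m) (G8.X j n) = G8.affineCoeff i j m n • c) ∧
          IsTwoCocycle G8.loopGrading G8.loopBracket 𝒱 ω' ∧
          IsCentralExtension G8.loopGrading G8.loopBracket (prodGrading G8.loopGrading 𝒱)
            (extBracket G8.loopBracket ω') (LinearMap.fst ℂ (Loop G8.Space) V))) ∧
    -- central extensions: after the choice of a degree preserving linear section `s`, the bracket
    -- is `[X^i_m, X^j_n] = f^{ij}_k X^k_{m+n} + g^{ij} m δ_{m+n,0} c`, with a unique central `c`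
    (∀ (E : Type*) [AddCommGroup E] [Module ℂ E] (𝓔 : Z22 → Submodule ℂ E)
      (brE : E →ₗ[ℂ] E →ₗ[ℂ] E) (π : E →ₗ[ℂ] Loop G8.Space),
      IsCentralExtension G8.loopGrading G8.loopBracket 𝓔 brE π →
      ∃! c : E, c ∈ 𝓔 (0, 0) ∧ π c = 0 ∧
        ∃ s : Loop G8.Space →ₗ[ℂ] E,
          IsDegreePreserving G8.loopGrading 𝓔 s ∧
          (∀ x : Loop G8.Space, π (s x) = x) ∧
          ∀ (i j : G8.Gen) (m n : ℤ),
            brE (s (G8.X i m)) (s (G8.X j n))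
              = s (G8.loopBracket (G8.X i m) (G8.X j n)) + G8.affineCoeff i j m n • c) := by
  refine ⟨G8.isZ22LieSuperalgebra_loop, ?_, ?_⟩
  · intro V _ _ 𝒱 h𝒱
    refine ⟨fun ω hω => hω.existsUnique, fun c hc => ?_⟩
    have h := G8.isTwoCocycle_affineCocycle hc
    exact ⟨G8.affineCocycle c, G8.affineCocycle_X c, h, h.isCentralExtension h𝒱⟩
  · intro E _ _ 𝓔 brE π h
    exact h.existsUnique
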